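/- Let $(X,\{R_i\}_{i=0}^d)$ be a $d$-class symmetric association scheme on a finite set $X$, with adjacency matrices $A_0=I,A_1,\dots,A_d$, which is $Q$-polynomial with respect to the ordering $E_0=\frac1{|X|}J,E_1,\dots,E_d$ of the primitive idempotents of its Bose--Mesner algebra; that is, for each $0\le i\le d$ there is a real polynomial $v_i^*$ of degree exactly $i$ such that $|X|E_i$ is obtained by applying $v_i^*$ to each entry of $|X|E_1$. Let $C\subseteq X$ be non-empty with characteristic vector $\chi$. Let $b_i=\frac{|X|}{|C|}\chi^TE_i\chi$ $(0\le i\le d)$ be its dual inner distribution, let $S(C)=\{j\mid 1\le j\le d,\ \chi^TA_j\chi\ne0\}$ be its degree set, and let $s=|S(C)|$ be its degree. Suppose that $C$ has a dual zero interval $\{w^*+1,\dots,w^*+t^*\}$, i.e. $0\le w^*\le d-1$, $1\le t^*\le d-w^*$ and $$b_{w^*+1}=\cdots=b_{w^*+t^*}=0.$$ If $2s-1\le t^*$, then $C$ with the relations $R_i\cap(C\times C)$, $i\in\{0\}\cup S(C)$, is an $s$-class $Q$-polynomial scheme, i.e. a symmetric association scheme with $s$ classes that is $Q$-polynomial with respect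 to some ordering of its primitive idempotents. -/

import Mathlib

noncomputable section

namespace QPolyScheme

/-- The adjacency matrix (with real entries) of a binary relation on a set. -/
def adjMat {X : Type*} (r : X → X → Prop) : Matrix X X ℝ :=
  open Classical in Matrix.of fun x y => if r x y then 1 else 0

/-- The family of relations `R`, indexed by `ι` with distinguished index `o`, is a symmetric
association scheme with `d` classes on the finite set `X`: there are `d + 1` relations, they are
non-empty, symmetric and partition `X × X`, the relation `R o` is equality, and the intersection
numbers exist. -/
structure IsSymmAssocScheme {X ι : Type*} [Fintype X] [Fintype ι]
    (d : ℕ) (o : ι) (R : ι → X → X → Prop) : Prop where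
  card_index : Fintype.card ι = d + 1
  diag : ∀ x y, R o x y ↔ x = y
  nonempty : ∀ i, ∃ x y, R i x y
  partition : ∀ x y, ∃! i, R i x y
  symm : ∀ i x y, R i x y → R i y x
  intersection_numbers : ∃ p : ι → ι → ι → ℕ, ∀ i j k x y, R k x y →
    {z : X | R i x z ∧ R j z y}.ncard = p i j k

/-- The Bose--Mesner algebra (as a space of matrices): the linear span of the adjacency
matrices. -/
def boseMesner {X ι : Type*} (R : ι → X → X → Prop) : Submodule ℝ (Matrix X X ℝ) :=
  Submodule.span ℝ (Set.range fun i => adjMat (R i))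

/-- `E 0, …, E d` is an ordering of the primitive idempotents of the Bose--Mesner algebra, with
`E 0 = |X|⁻¹ J`: a basis of that algebra formed by non-zero mutually orthogonal idempotents
that sum to the identity. -/
structure IsIdempotentOrdering {X ι : Type*} [Fintype X] [DecidableEq X] {d : ℕ}
    (R : ι → X → X → Prop) (E : Fin (d + 1) → Matrix X X ℝ) : Prop where
  ne_zero : ∀ i, E i ≠ 0
  idem : ∀ i, E i * E i = E i
  orthogonal : ∀ i j, i ≠ j → E i * E j = 0
  sum_eq_one : ∑ i, E i = 1
  span_eq : Submodule.span ℝ (Set.range E) = boseMesner R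
  zero_eq : E 0 = (Fintype.card X : ℝ)⁻¹ • Matrix.of fun _ _ => 1

/-- `R` is a symmetric association scheme with `d` classes which is `Q`-polynomial with respect
to the ordering `E 0, …, E d` of its primitive idempotents: for each `i`, the matrix `|X| E i` is
obtained from `|X| E 1` by applying entrywise a polynomial of degree exactly `i`.
(For `d = 0`, where there is no `E 1`, the index `1 : Fin 1` is `0` and the last condition holds
trivially.) -/
structure IsQPolynomialWith {X ι : Type*} [Fintype X] [DecidableEq X] [Fintype ι]
    (d : ℕ) (o : ι) (R : ι → X → X → Prop) (E : Fin (d + 1) → Matrix X X ℝ) : Prop where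
  scheme : IsSymmAssocScheme d o R
  ordering : IsIdempotentOrdering R E
  polynomial : ∃ v : Fin (d + 1) → Polynomial ℝ, ∀ i, (v i).degree = ((i : ℕ) : WithBot ℕ) ∧
    ∀ x y, (Fintype.card X : ℝ) * E i x y = (v i).eval ((Fintype.card X : ℝ) * E 1 x y)

/-- `R` is a `d`-class `Q`-polynomial scheme: it is `Q`-polynomial with respect to some ordering
of its primitive idempotents. -/
def IsQPolynomialScheme {X ι : Type*} [Fintype X] [DecidableEq X] [Fintype ι]
    (d : ℕ) (o : ι) (R : ι → X → X → Prop) : Prop :=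
  ∃ E : Fin (d + 1) → Matrix X X ℝ, IsQPolynomialWith d o R E

/-- The characteristic vector of a subset. -/
def charVec {X : Type*} [DecidableEq X] (C : Finset X) : X → ℝ :=
  fun x => if x ∈ C then 1 else 0

/-- The quadratic form `χᵀ M χ` at the characteristic vector `χ` of `C`. -/
def charForm {X : Type*} [Fintype X] [DecidableEq X] (C : Finset X) (M : Matrix X X ℝ) : ℝ :=
  charVec C ⬝ᵥ Matrix.mulVec M (charVec C)

/-- The dual inner distribution `b_i = (|X| / |C|) χᵀ E_i χ` of `C`. -/
def dualInnerDistribution {X : Type*} [Fintype X] [DecidableEq X] {d : ℕ}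
    (E : Fin (d + 1) → Matrix X X ℝ) (C : Finset X) (i : Fin (d + 1)) : ℝ :=
  ((Fintype.card X : ℝ) / (C.card : ℝ)) * charForm C (E i)

/-- `C` has the dual zero interval `{w + 1, …, w + t}`, where `0 ≤ w ≤ d - 1` and
`1 ≤ t ≤ d - w`. -/
structure HasDualZeroInterval {X : Type*} [Fintype X] [DecidableEq X] {d : ℕ}
    (E : Fin (d + 1) → Matrix X X ℝ) (C : Finset X) (w t : ℕ) : Prop where
  lt : w < d
  one_le : 1 ≤ t
  add_le : w + t ≤ d
  vanish : ∀ k : Fin (d + 1), w + 1 ≤ (k : ℕ) → (k : ℕ) ≤ w + t →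
    dualInnerDistribution E C k = 0

/-- The degree set `S(C) = {j | 1 ≤ j ≤ d, χᵀ A_j χ ≠ 0}`. -/
def degreeSet {X : Type*} [Fintype X] [DecidableEq X] {d : ℕ}
    (R : Fin (d + 1) → X → X → Prop) (C : Finset X) : Finset (Fin (d + 1)) :=
  open Classical in Finset.univ.filter fun j => 1 ≤ (j : ℕ) ∧ charForm C (adjMat (R j)) ≠ 0

/-- The degree `s = |S(C)|`. -/
def degree {X : Type*} [Fintype X] [DecidableEq X] {d : ℕ}
    (R : Fin (d + 1) → X → X → Prop) (C : Finset X) : ℕ :=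
  (degreeSet R C).card

/-- The family `R^C` of the relations `R_i ∩ (C × C)` on `C`, for `i ∈ {0} ∪ S(C)`. -/
def restrictedRel {X : Type*} [Fintype X] [DecidableEq X] {d : ℕ}
    (R : Fin (d + 1) → X → X → Prop) (C : Finset X) :
    {i : Fin (d + 1) // i ∈ insert 0 (degreeSet R C)} →
      {x : X // x ∈ C} → {x : X // x ∈ C} → Prop :=
  fun i x y => R i.1 x.1 y.1

end QPolyScheme

end

noncomputable section

namespace QPolyScheme

open Matrix Submodule

/-! Write `F k` for the restriction of `E k` to `C × C`. Entries of `E 1` separate the relations, so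
by interpolation `F 0, …, F s` span the space `W` of matrices constant on the restricted relations
(`span_restrict`). The difficulty is that `W` must be shown closed under multiplication.

Let `w'` be the last index up to `w` at which the dual distribution is non-zero, and let `G i` be
the restriction of `E (w' + i)`. The trace of a product of two restricted idempotents is a
combination of the values `χᵀ E_l χ` with Krein-type coefficients, which are non-negative and obey
the triangle inequality of a `Q`-polynomial ordering. For `k < i ≤ s` the coefficients for `G i * F
k` can be non-zero only at indices `l` with `w' < l ≤ w' + 2s - 1`, where `χᵀ E_l χ` vanishes; two
positive semidefinite matrices whose product has trace zero have product zero, so `G i * F k = 0`.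
For `k = i` the index `w'` contributes a positive term, so `G i * F i ≠ 0`.

Such triangularity alone splits `W` into mutually orthogonal idempotents `P 0, …, P s` adapted to
the flag of the `F k` (`exists_orthogonal_idempotents`). They span `W`, which is therefore an
algebra, and each `P i` is a polynomial of degree exactly `i` in the restricted `E 1`. -/

/-! ### Orthogonal idempotents from a triangular pair of families -/

theorem eq_zero_of_isSymm_of_mul_self_eq_zero {Y : Type*} [Fintype Y] {A : Matrix Y Y ℝ}
    (hA : A.IsSymm) (h : A * A = 0) : A = 0 := by
  apply Matrix.conjTranspose_mul_self_eq_zero.1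
  rw [Matrix.conjTranspose_eq_transpose_of_trivial, hA.eq, h]

theorem isSymm_of_mem_span {Y : Type*} {S : Set (Matrix Y Y ℝ)} (hS : ∀ A ∈ S, A.IsSymm)
    {A : Matrix Y Y ℝ} (hA : A ∈ span ℝ S) : A.IsSymm := by
  induction hA using span_induction with
  | mem x hx => exact hS x hx
  | zero => exact Matrix.isSymm_zero
  | add x y _ _ hx hy => exact hx.add hy
  | smul a x _ hx => exact hx.smul a

theorem mul_eq_zero_of_mem_span {Y : Type*} [Fintype Y] {S T : Set (Matrix Y Y ℝ)}
    (h : ∀ A ∈ S, ∀ B ∈ T, A * B = 0) {A B : Matrix Y Y ℝ} (hA : A ∈ span ℝ S)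
    (hB : B ∈ span ℝ T) : A * B = 0 := by
  induction hA using span_induction with
  | zero => simp
  | add x y _ _ hx hy => rw [add_mul, hx, hy, add_zero]
  | smul a x _ hx => rw [smul_mul_assoc, hx, smul_zero]
  | mem x hx =>
    induction hB using span_induction with
    | mem y hy => exact h x hx y hy
    | zero => simp
    | add y z _ _ hy hz => rw [mul_add, hy, hz, add_zero]
    | smul a y _ hy => rw [mul_smul_comm, hy, smul_zero]

theorem mem_span_image_Iio_succ {V : Type*} [AddCommGroup V] [Module ℝ V] {F : ℕ → V} {i : ℕ}
    {x : V} : x ∈ span ℝ (F '' Set.Iio (i + 1)) ↔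
      ∃ a : ℝ, x - a • F i ∈ span ℝ (F '' Set.Iio i) := by
  have : Set.Iio (i + 1) = insert i (Set.Iio i) := by
    ext k; simp only [Set.mem_Iio, Set.mem_insert_iff]; omega
  rw [this, Set.image_insert_eq, mem_span_insert]
  constructor
  · rintro ⟨a, z, hz, rfl⟩
    exact ⟨a, by simpa using hz⟩
  · rintro ⟨a, h⟩
    exact ⟨a, _, h, by simp⟩

/-- If symmetric matrices `G i` in the span of symmetric matrices `F 0, …, F s` are triangular
with respect to them, then that span is the sum of those of `F k`, `k < i`, and of `G k`,
`i ≤ k ≤ s`. -/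
theorem span_le_sup_of_triangular {Y : Type*} [Fintype Y] {s : ℕ} {F G : ℕ → Matrix Y Y ℝ}
    (hF : ∀ k, (F k).IsSymm)
    (hGW : ∀ i ≤ s, G i ∈ span ℝ (F '' Set.Iio (s + 1)))
    (h0 : ∀ i ≤ s, ∀ k < i, G i * F k = 0) (hne : ∀ i ≤ s, G i * F i ≠ 0) {i : ℕ}
    (hi : i ≤ s + 1) :
    span ℝ (F '' Set.Iio (s + 1)) ≤
      span ℝ (F '' Set.Iio i) ⊔ span ℝ (G '' Set.Icc i s) := by
  induction hi using Nat.decreasingInduction with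
  | self => exact le_sup_left
  | of_succ i hi ih =>
    have his : i ≤ s := by omega
    have hGmono : span ℝ (G '' Set.Icc (i + 1) s) ≤ span ℝ (G '' Set.Icc i s) :=
      span_mono (Set.image_mono fun k hk => ⟨by have := hk.1; omega, hk.2⟩)
    have hGi : G i ∈ span ℝ (G '' Set.Icc i s) := subset_span ⟨i, ⟨le_rfl, his⟩, rfl⟩
    refine ih.trans (sup_le ?_ (hGmono.trans le_sup_right))
    obtain ⟨y, hy, z, hz, hyz⟩ := mem_sup.1 (ih (hGW i his))
    obtain ⟨a, ha⟩ := mem_span_image_Iio_succ.1 hy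
    -- If `a = 0`, then `y` lies both in the span of the `F k`, `k < i`, and in that of the `G k`,
    -- `k ≥ i`, so `y * y = 0` and `y = 0`. Then `G i = z` kills `F i`. With `a ≠ 0`, `F i` can be
    -- exchanged for `G i`.
    have ha0 : a ≠ 0 := by
      rintro rfl
      rw [zero_smul, sub_zero] at ha
      have hysymm : y.IsSymm := isSymm_of_mem_span (by rintro _ ⟨k, -, rfl⟩; exact hF k) hy
      have hyG : y ∈ span ℝ (G '' Set.Icc i s) := by
        rw [show y = G i - z by rw [← hyz]; simp]
        exact sub_mem hGi (hGmono hz)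
      have hy0 : y = 0 := by
        refine eq_zero_of_isSymm_of_mul_self_eq_zero hysymm (mul_eq_zero_of_mem_span ?_ hyG ha)
        rintro _ ⟨k, hk, rfl⟩ _ ⟨l, hl, rfl⟩
        exact h0 k hk.2 l (lt_of_lt_of_le hl hk.1)
      refine hne i his (mul_eq_zero_of_mem_span (S := G '' Set.Icc (i + 1) s) (T := {F i}) ?_ ?_
        (subset_span rfl))
      · rintro _ ⟨k, hk, rfl⟩ _ rfl
        exact h0 k hk.2 i hk.1
      · rw [← hyz, hy0, zero_add]; exact hz
    have hFi : F i ∈ span ℝ (F '' Set.Iio i) ⊔ span ℝ (G '' Set.Icc i s) := by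
      have : F i = a⁻¹ • (G i - z - (y - a • F i)) := by
        rw [← hyz, show y + z - z - (y - a • F i) = a • F i by abel, smul_smul,
          inv_mul_cancel₀ ha0, one_smul]
      rw [this]
      exact smul_mem _ _ (sub_mem (mem_sup_right (sub_mem hGi (hGmono hz))) (mem_sup_left ha))
    intro x hx
    obtain ⟨b, hb⟩ := mem_span_image_Iio_succ.1 hx
    rw [← sub_add_cancel x (b • F i)]
    exact add_mem (mem_sup_left hb) (smul_mem _ _ hFi)

/-- The component `Q i` of `1` in the span of the `G k`, `k ≥ i`, is a projection killing the `F k`,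
`k < i`. These projections are nested, and their successive differences are the required
idempotents. Closure of the span under multiplication is not assumed; it will follow from this
lemma. -/
theorem exists_orthogonal_idempotents {Y : Type*} [Fintype Y] [DecidableEq Y] {s : ℕ}
    {F G : ℕ → Matrix Y Y ℝ} (hF : ∀ k, (F k).IsSymm) (hG : ∀ k, (G k).IsSymm)
    (h1 : 1 ∈ span ℝ (F '' Set.Iio (s + 1)))
    (hGW : ∀ i ≤ s, G i ∈ span ℝ (F '' Set.Iio (s + 1)))
    (h0 : ∀ i ≤ s, ∀ k < i, G i * F k = 0) (hne : ∀ i ≤ s, G i * F i ≠ 0) :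
    ∃ P : ℕ → Matrix Y Y ℝ, (∀ i ≤ s, P i * P i = P i) ∧
      (∀ i ≤ s, ∀ j ≤ s, i ≠ j → P i * P j = 0) ∧ ∑ i ∈ Finset.range (s + 1), P i = 1 ∧
      ∀ i ≤ s, P i ∈ span ℝ (F '' Set.Iio (i + 1)) ∧ P i ∉ span ℝ (F '' Set.Iio i) := by
  -- The bound on `i` stands inside the existential so that `Q` becomes a function on all of `ℕ`.
  have key : ∀ i, ∃ q : Matrix Y Y ℝ, i ≤ s + 1 →
      1 - q ∈ span ℝ (F '' Set.Iio i) ∧ q ∈ span ℝ (G '' Set.Icc i s) := by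
    intro i
    by_cases hi : i ≤ s + 1
    · obtain ⟨y, hy, z, hz, hyz⟩ := mem_sup.1 (span_le_sup_of_triangular hF hGW h0 hne hi h1)
      exact ⟨z, fun _ => ⟨by rw [← hyz]; simpa using hy, hz⟩⟩
    · exact ⟨0, fun h => absurd h hi⟩
  choose Q hQ using key
  have hGF : ∀ i ≤ s + 1, ∀ z ∈ span ℝ (G '' Set.Icc i s), ∀ y ∈ span ℝ (F '' Set.Iio i),
      z * y = 0 := by
    intro i _ z hz y hy
    refine mul_eq_zero_of_mem_span ?_ hz hy
    rintro _ ⟨k, hk, rfl⟩ _ ⟨l, hl, rfl⟩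
    exact h0 k hk.2 l (lt_of_lt_of_le hl hk.1)
  have hFG : ∀ i ≤ s + 1, ∀ z ∈ span ℝ (G '' Set.Icc i s), ∀ y ∈ span ℝ (F '' Set.Iio i),
      y * z = 0 := by
    intro i hi z hz y hy
    have hys : y.IsSymm := isSymm_of_mem_span (by rintro _ ⟨k, -, rfl⟩; exact hF k) hy
    have hzs : z.IsSymm := isSymm_of_mem_span (by rintro _ ⟨k, -, rfl⟩; exact hG k) hz
    -- Transposition turns `z * y = 0` into `y * z = 0`, as both factors are symmetric.
    rw [← hys.eq, ← hzs.eq, ← Matrix.transpose_mul, hGF i hi z hz y hy, Matrix.transpose_zero]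
  have hmono : ∀ {i j}, i ≤ j → span ℝ (G '' Set.Icc j s) ≤ span ℝ (G '' Set.Icc i s) :=
    fun h => span_mono (Set.image_mono fun k hk => ⟨h.trans hk.1, hk.2⟩)
  have hl : ∀ i j, i ≤ j → j ≤ s + 1 → Q i * Q j = Q j := by
    intro i j hij hj
    have := hFG i (hij.trans hj) _ (hmono hij (hQ j hj).2) _ (hQ i (hij.trans hj)).1
    rw [sub_mul, one_mul, sub_eq_zero] at this
    exact this.symm
  have hr : ∀ i j, i ≤ j → j ≤ s + 1 → Q j * Q i = Q j := by
    intro i j hij hj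
    have := hGF i (hij.trans hj) _ (hmono hij (hQ j hj).2) _ (hQ i (hij.trans hj)).1
    rw [mul_sub, mul_one, sub_eq_zero] at this
    exact this.symm
  have hQ0 : Q 0 = 1 := by
    have := (hQ 0 (Nat.zero_le _)).1
    have he : Set.Iio 0 = (∅ : Set ℕ) := by ext; simp
    rw [he, Set.image_empty, span_empty, mem_bot, sub_eq_zero] at this
    exact this.symm
  have hQs : Q (s + 1) = 0 := by
    have := (hQ (s + 1) le_rfl).2
    rwa [Set.Icc_eq_empty (by omega), Set.image_empty, span_empty, mem_bot] at this
  refine ⟨fun i => Q i - Q (i + 1), ?_, ?_, ?_, ?_⟩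
  · intro i hi
    simp only [sub_mul, mul_sub]
    rw [hl i i le_rfl (by omega), hl i (i + 1) (by omega) (by omega),
      hr i (i + 1) (by omega) (by omega), hl (i + 1) (i + 1) le_rfl (by omega)]
    abel
  · intro i hi j hj hij
    simp only [sub_mul, mul_sub]
    rcases lt_or_gt_of_ne hij with h | h
    · rw [hl i j (by omega) (by omega), hl i (j + 1) (by omega) (by omega),
        hl (i + 1) j (by omega) (by omega), hl (i + 1) (j + 1) (by omega) (by omega)]
      abel
    · rw [hr j i (by omega) (by omega), hr j (i + 1) (by omega) (by omega),
        hr (j + 1) i (by omega) (by omega), hr (j + 1) (i + 1) (by omega) (by omega)]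
      abel
  · rw [Finset.sum_range_sub', hQ0, hQs, sub_zero]
  · intro i hi
    beta_reduce
    have hFmono : span ℝ (F '' Set.Iio i) ≤ span ℝ (F '' Set.Iio (i + 1)) :=
      span_mono (Set.image_mono fun k hk => Nat.lt_succ_of_lt hk)
    constructor
    · rw [show Q i - Q (i + 1) = (1 - Q (i + 1)) - (1 - Q i) by abel]
      exact sub_mem (hQ (i + 1) (by omega)).1 (hFmono (hQ i (by omega)).1)
    intro ha
    -- Membership in the smaller span would force `Q i = Q (i + 1)`; then `G i = G i * Q i = G i * Q
    -- (i + 1)`, and `Q (i + 1)` kills `F i`.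
    have hz := hGF i (by omega) _ (hQ i (by omega)).2 _ ha
    rw [mul_sub, hl i i le_rfl (by omega), hl i (i + 1) (by omega) (by omega), sub_eq_zero] at hz
    have hGi : G i ∈ span ℝ (G '' Set.Icc i s) := subset_span ⟨i, ⟨le_rfl, hi⟩, rfl⟩
    have hFi : F i ∈ span ℝ (F '' Set.Iio (i + 1)) := subset_span ⟨i, Nat.lt_succ_self i, rfl⟩
    have h2 := hGF i (by omega) _ hGi _ (hQ i (by omega)).1
    have h3 := hGF (i + 1) (by omega) _ (hQ (i + 1) (by omega)).2 _ hFi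
    rw [mul_sub, mul_one, sub_eq_zero] at h2
    apply hne i hi
    rw [h2, hz, mul_assoc, h3, mul_zero]

/-! ### Matrices constant on relations, and entrywise polynomials -/

theorem adjMat_apply_congr {X ι : Type*} {R : ι → X → X → Prop}
    (hp : ∀ x y, ∃! i, R i x y) {i k : ι} {x y x' y' : X} (h : R k x y) (h' : R k x' y') :
    adjMat (R i) x y = adjMat (R i) x' y' := by
  have : R i x y ↔ R i x' y' := by
    constructor
    · intro h1; obtain rfl := (hp x y).unique h1 h; exact h'
    · intro h1; obtain rfl := (hp x' y').unique h1 h'; exact h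
  by_cases h1 : R i x y
  · simp [adjMat, h1, this.1 h1]
  · simp [adjMat, h1, mt this.2 h1]

/-- The span of the adjacency matrices of a partition into non-empty relations consists of the
matrices that are constant on each relation. -/
theorem mem_boseMesner_iff {X ι : Type*} [Fintype ι] {R : ι → X → X → Prop}
    (hne : ∀ i, ∃ x y, R i x y) (hp : ∀ x y, ∃! i, R i x y) {B : Matrix X X ℝ} :
    B ∈ boseMesner R ↔
      ∀ i x y x' y', R i x y → R i x' y' → B x y = B x' y' := by
  constructor
  · intro hB i x y x' y' h h'
    unfold boseMesner at hB
    induction hB using span_induction with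
    | mem A hA => obtain ⟨j, rfl⟩ := hA; exact adjMat_apply_congr hp h h'
    | zero => rfl
    | add A A' _ _ hA hA' => rw [Matrix.add_apply, Matrix.add_apply, hA, hA']
    | smul a A _ hA => rw [Matrix.smul_apply, Matrix.smul_apply, hA]
  · intro hB
    choose x y hxy using hne
    have : B = ∑ k, B (x k) (y k) • adjMat (R k) := by
      ext u v
      obtain ⟨k, hk, huniq⟩ := hp u v
      rw [Matrix.sum_apply, Finset.sum_eq_single k]
      · simp [adjMat, hk, hB k u v (x k) (y k) hk (hxy k)]
      · intro j _ hj
        have : ¬ R j u v := fun h => hj (huniq j h)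
        simp [adjMat, this]
      · simp
    rw [this]
    exact sum_mem fun k _ => smul_mem _ _ (subset_span ⟨k, rfl⟩)

/-- The matrix obtained by applying a polynomial to each entry of `M`, as a linear map in the
polynomial. -/
def entrywise {Y : Type*} (M : Matrix Y Y ℝ) : Polynomial ℝ →ₗ[ℝ] Matrix Y Y ℝ where
  toFun p := Matrix.of fun x y => p.eval (M x y)
  map_add' p q := by ext; simp
  map_smul' a p := by ext; simp

@[simp]
theorem entrywise_apply {Y : Type*} (M : Matrix Y Y ℝ) (p : Polynomial ℝ) (x y : Y) :
    entrywise M p x y = p.eval (M x y) := rfl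

theorem mem_span_of_degree_lt {v : ℕ → Polynomial ℝ} {d : ℕ}
    (hv : ∀ k ≤ d, (v k).degree = (k : WithBot ℕ)) {m : ℕ} (hm : m ≤ d + 1) {p : Polynomial ℝ}
    (hp : p.degree < (m : WithBot ℕ)) : p ∈ span ℝ (v '' Set.Iio m) := by
  induction m generalizing p with
  | zero =>
    have : p = 0 := by
      rw [← Polynomial.degree_eq_bot]
      simpa [Nat.WithBot.lt_zero_iff] using hp
    rw [this]; exact zero_mem _
  | succ m ih =>
    rw [mem_span_image_Iio_succ]
    have hvm := hv m (by omega)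
    have hlead : (v m).coeff m ≠ 0 := Polynomial.coeff_ne_zero_of_eq_degree hvm
    -- This multiple of `v m` cancels the coefficient of degree `m`.
    refine ⟨p.coeff m / (v m).coeff m, ih (by omega) ?_⟩
    rw [Polynomial.degree_lt_iff_coeff_zero]
    intro k hk
    rw [Polynomial.coeff_sub, Polynomial.coeff_smul, smul_eq_mul]
    rcases hk.eq_or_lt with rfl | hk
    · field_simp; ring
    · have h1 : p.coeff k = 0 :=
        Polynomial.coeff_eq_zero_of_degree_lt (hp.trans_le (by exact_mod_cast hk))
      have h2 : (v m).coeff k = 0 :=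
        Polynomial.coeff_eq_zero_of_degree_lt (hvm.trans_lt (by exact_mod_cast hk))
      simp [h1, h2]

theorem entrywise_mem_span {Y : Type*} {M : Matrix Y Y ℝ} {F : ℕ → Matrix Y Y ℝ}
    {v : ℕ → Polynomial ℝ} {d : ℕ} (hv : ∀ k ≤ d, (v k).degree = (k : WithBot ℕ)) {n : ℝ}
    (hF : ∀ k ≤ d, n • F k = entrywise M (v k)) {m : ℕ} (hm : m ≤ d + 1) {p : Polynomial ℝ}
    (hp : p.degree < (m : WithBot ℕ)) : entrywise M p ∈ span ℝ (F '' Set.Iio m) := by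
  have := mem_map_of_mem (f := entrywise M) (mem_span_of_degree_lt hv hm hp)
  rw [map_span] at this
  refine span_le.2 ?_ this
  rintro _ ⟨_, ⟨k, hk, rfl⟩, rfl⟩
  rw [← hF k (by have : k < m := hk; omega)]
  exact smul_mem _ _ (subset_span ⟨k, hk, rfl⟩)

theorem exists_entrywise_of_mem_span {Y : Type*} {M : Matrix Y Y ℝ} {F : ℕ → Matrix Y Y ℝ}
    {v : ℕ → Polynomial ℝ} {d : ℕ} (hv : ∀ k ≤ d, (v k).degree = (k : WithBot ℕ)) {n : ℝ}
    (hn : n ≠ 0) (hF : ∀ k ≤ d, n • F k = entrywise M (v k)) {m : ℕ} (hm : m ≤ d + 1)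
    {A : Matrix Y Y ℝ} (hA : A ∈ span ℝ (F '' Set.Iio m)) :
    ∃ p : Polynomial ℝ, p.degree < (m : WithBot ℕ) ∧ A = entrywise M p := by
  induction hA using span_induction with
  | mem A hA =>
    obtain ⟨k, hk, rfl⟩ := hA
    have hk : k < m := hk
    refine ⟨n⁻¹ • v k, (Polynomial.degree_smul_le _ _).trans_lt ?_, ?_⟩
    · rw [hv k (by omega)]; exact_mod_cast hk
    · rw [map_smul, ← hF k (by omega), smul_smul, inv_mul_cancel₀ hn, one_smul]
  | zero => exact ⟨0, by simp, by simp⟩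
  | add A B _ _ hA hB =>
    obtain ⟨p, hp, rfl⟩ := hA
    obtain ⟨q, hq, rfl⟩ := hB
    exact ⟨p + q, (Polynomial.degree_add_le _ _).trans_lt (max_lt hp hq), by simp⟩
  | smul a A _ hA =>
    obtain ⟨p, hp, rfl⟩ := hA
    exact ⟨a • p, (Polynomial.degree_smul_le _ _).trans_lt hp, by simp⟩

/-! ### Positivity of traces and Krein parameters -/

theorem trace_mul_eq_sum {Y : Type*} [Fintype Y] {A B : Matrix Y Y ℝ} (hB : B.IsSymm) :
    (A * B).trace = ∑ x, ∑ y, A x y * B x y := by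
  simp only [Matrix.trace, Matrix.diag, Matrix.mul_apply]
  exact Finset.sum_congr rfl fun x _ => Finset.sum_congr rfl fun y _ => by rw [hB.apply]

theorem posSemidef_of_isSymm_of_mul_self {Y : Type*} [Fintype Y] {A : Matrix Y Y ℝ}
    (hA : A.IsSymm) (h : A * A = A) : A.PosSemidef := by
  have := Matrix.posSemidef_conjTranspose_mul_self A
  rwa [Matrix.conjTranspose_eq_transpose_of_trivial, hA.eq, h] at this

/-- With `A = Kᴴ K` and `B = Nᴴ N`, the trace of `A * B` is the squared Frobenius norm of `K Nᴴ`,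
which is a middle factor of `A * B`. -/
theorem PosSemidef.mul_eq_zero_of_trace_eq_zero {Y : Type*} [Fintype Y] [DecidableEq Y]
    {A B : Matrix Y Y ℝ} (hA : A.PosSemidef) (hB : B.PosSemidef) (h : (A * B).trace = 0) :
    A * B = 0 := by
  open scoped MatrixOrder in
  obtain ⟨K, rfl⟩ := CStarAlgebra.nonneg_iff_eq_star_mul_self.mp hA.nonneg
  obtain ⟨N, rfl⟩ := CStarAlgebra.nonneg_iff_eq_star_mul_self.mp hB.nonneg
  have h2 : ((K * star N)ᴴ * (K * star N)).trace = 0 := by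
    rw [← h]
    simp only [Matrix.star_eq_conjTranspose, Matrix.conjTranspose_mul,
      Matrix.conjTranspose_conjTranspose]
    rw [Matrix.trace_mul_comm, ← Matrix.mul_assoc, Matrix.mul_assoc (K * Nᴴ), Matrix.trace_mul_comm,
      Matrix.mul_assoc, Matrix.trace_mul_comm]
    simp only [Matrix.mul_assoc]
  have h3 := Matrix.trace_conjTranspose_mul_self_eq_zero_iff.1 h2
  rw [show star K * K * (star N * N) = star K * (K * star N) * N by simp only [Matrix.mul_assoc],
    h3, Matrix.mul_zero, Matrix.zero_mul]

theorem charForm_eq_sum {X : Type*} [Fintype X] [DecidableEq X] (C : Finset X)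
    (M : Matrix X X ℝ) : charForm C M = ∑ x ∈ C, ∑ y ∈ C, M x y := by
  simp [charForm, charVec, dotProduct, Matrix.mulVec]

/-- The sum of the entries of `A ⊙ B ⊙ D`; up to a normalization this is a Krein parameter when
`A`, `B`, `D` are primitive idempotents. -/
def tripleSum {X : Type*} [Fintype X] (A B D : Matrix X X ℝ) : ℝ :=
  ∑ x, ∑ y, A x y * B x y * D x y

theorem tripleSum_comm {X : Type*} [Fintype X] (A B D : Matrix X X ℝ) :
    tripleSum A B D = tripleSum A D B :=
  Finset.sum_congr rfl fun _ _ => Finset.sum_congr rfl fun _ _ => by ring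

theorem tripleSum_swap {X : Type*} [Fintype X] (A B D : Matrix X X ℝ) :
    tripleSum A B D = tripleSum B A D :=
  Finset.sum_congr rfl fun _ _ => Finset.sum_congr rfl fun _ _ => by ring

theorem tripleSum_eq_trace {X : Type*} [Fintype X] (A B : Matrix X X ℝ) {D : Matrix X X ℝ}
    (hD : D.IsSymm) : tripleSum A B D = ((A ⊙ B) * D).trace := by
  rw [trace_mul_eq_sum hD]; rfl

/-- The Krein condition: `A ⊙ B` is positive semidefinite by Schur's product theorem, and the sum is
the trace of its compression by the projection `D`. -/
theorem tripleSum_nonneg {X : Type*} [Fintype X] {A B D : Matrix X X ℝ}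
    (hA : A.PosSemidef) (hB : B.PosSemidef) (hD : D.IsSymm) (hD2 : D * D = D) :
    0 ≤ tripleSum A B D := by
  have h := ((hA.hadamard hB).mul_mul_conjTranspose_same D).trace_nonneg
  rw [Matrix.conjTranspose_eq_transpose_of_trivial, hD.eq, Matrix.mul_assoc,
    Matrix.trace_mul_comm, Matrix.mul_assoc, hD2] at h
  rwa [tripleSum_eq_trace _ _ hD]

theorem IsIdempotentOrdering.mem {X ι : Type*} [Fintype X] [DecidableEq X] {d : ℕ}
    {R : ι → X → X → Prop} {E : Fin (d + 1) → Matrix X X ℝ} (h : IsIdempotentOrdering R E) (i : Fin (d + 1)) :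
    E i ∈ boseMesner R := by
  rw [← h.span_eq]; exact subset_span ⟨i, rfl⟩

section Scheme

variable {X ι : Type*} [Fintype X] [Fintype ι] {d : ℕ} {o : ι} {R : ι → X → X → Prop}

theorem IsSymmAssocScheme.mem_boseMesner_iff (h : IsSymmAssocScheme d o R)
    {B : Matrix X X ℝ} : B ∈ boseMesner R ↔
      ∀ i x y x' y', R i x y → R i x' y' → B x y = B x' y' :=
  QPolyScheme.mem_boseMesner_iff h.nonempty h.partition

theorem IsSymmAssocScheme.isSymm_of_mem (h : IsSymmAssocScheme d o R)
    {B : Matrix X X ℝ} (hB : B ∈ boseMesner R) : B.IsSymm := by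
  ext x y
  obtain ⟨k, hk, -⟩ := h.partition x y
  exact h.mem_boseMesner_iff.1 hB k _ _ _ _ (h.symm k x y hk) hk

theorem IsSymmAssocScheme.hadamard_mem (h : IsSymmAssocScheme d o R)
    {A B : Matrix X X ℝ} (hA : A ∈ boseMesner R) (hB : B ∈ boseMesner R) :
    A ⊙ B ∈ boseMesner R := by
  rw [h.mem_boseMesner_iff] at *
  intro i x y x' y' hx hy
  rw [Matrix.hadamard_apply, Matrix.hadamard_apply, hA i x y x' y' hx hy, hB i x y x' y' hx hy]

variable [DecidableEq X] {E : Fin (d + 1) → Matrix X X ℝ}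

theorem IsQPolynomialWith.isSymm (h : IsQPolynomialWith d o R E) (i : Fin (d + 1)) :
    (E i).IsSymm :=
  h.scheme.isSymm_of_mem (h.ordering.mem i)

theorem IsQPolynomialWith.posSemidef (h : IsQPolynomialWith d o R E) (i : Fin (d + 1)) :
    (E i).PosSemidef :=
  posSemidef_of_isSymm_of_mul_self (h.isSymm i) (h.ordering.idem i)

theorem IsQPolynomialWith.trace_pos (h : IsQPolynomialWith d o R E) (i : Fin (d + 1)) :
    0 < (E i).trace := by
  refine lt_of_le_of_ne (h.posSemidef i).trace_nonneg fun h0 => h.ordering.ne_zero i ?_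
  rw [← h.ordering.idem i]
  exact PosSemidef.mul_eq_zero_of_trace_eq_zero (h.posSemidef i) (h.posSemidef i)
    (by rw [h.ordering.idem i, ← h0])

theorem IsQPolynomialWith.tripleSum_nonneg (h : IsQPolynomialWith d o R E)
    (i j k : Fin (d + 1)) : 0 ≤ tripleSum (E i) (E j) (E k) :=
  QPolyScheme.tripleSum_nonneg (h.posSemidef i) (h.posSemidef j) (h.isSymm k) (h.ordering.idem k)

theorem IsQPolynomialWith.hadamard_eq_sum (h : IsQPolynomialWith d o R E) (i j : Fin (d + 1)) :
    E i ⊙ E j = ∑ k, (tripleSum (E i) (E j) (E k) / (E k).trace) • E k := by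
  have hm := h.scheme.hadamard_mem (h.ordering.mem i) (h.ordering.mem j)
  rw [← h.ordering.span_eq, mem_span_range_iff_exists_fun] at hm
  obtain ⟨c, hc⟩ := hm
  rw [← hc]
  refine Finset.sum_congr rfl fun k _ => ?_
  congr 1
  rw [tripleSum_eq_trace _ _ (h.isSymm k), ← hc, Finset.sum_mul, Matrix.trace_sum,
    Finset.sum_eq_single k]
  · rw [smul_mul_assoc, h.ordering.idem k, Matrix.trace_smul, smul_eq_mul,
      mul_div_cancel_right₀ _ (h.trace_pos k).ne']
  · intro l _ hl
    rw [smul_mul_assoc, h.ordering.orthogonal l k hl, smul_zero, Matrix.trace_zero]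
  · simp

end Scheme

/-- The idempotents indexed by natural numbers, with values modulo `d + 1`. -/
def natIdem {X : Type*} {d : ℕ} (E : Fin (d + 1) → Matrix X X ℝ) (k : ℕ) : Matrix X X ℝ :=
  E (Fin.ofNat (d + 1) k)

theorem natIdem_val {X : Type*} {d : ℕ} (E : Fin (d + 1) → Matrix X X ℝ) (k : Fin (d + 1)) :
    natIdem E k = E k := by
  simp [natIdem]

/-! ### Krein parameters of a `Q`-polynomial ordering -/

section QPolynomial

variable {X ι : Type*} [Fintype X] [DecidableEq X] [Fintype ι] {d : ℕ} {o : ι}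
  {R : ι → X → X → Prop} {E : Fin (d + 1) → Matrix X X ℝ}

theorem IsQPolynomialWith.card_ne_zero (h : IsQPolynomialWith d o R E) :
    (Fintype.card X : ℝ) ≠ 0 := by
  obtain ⟨x, -⟩ := h.scheme.nonempty o
  have : Nonempty X := ⟨x⟩
  exact_mod_cast Fintype.card_ne_zero

theorem IsQPolynomialWith.exists_polynomials (h : IsQPolynomialWith d o R E) :
    ∃ v : ℕ → Polynomial ℝ, (∀ k ≤ d, (v k).degree = (k : WithBot ℕ)) ∧
      ∀ k ≤ d, (Fintype.card X : ℝ) • natIdem E k =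
        entrywise ((Fintype.card X : ℝ) • natIdem E 1) (v k) := by
  obtain ⟨v, hv⟩ := h.polynomial
  refine ⟨fun k => v (Fin.ofNat (d + 1) k), fun k hk => ?_, fun k hk => ?_⟩
  · rw [(hv _).1, Fin.val_ofNat, Nat.mod_eq_of_lt (by omega)]
  · ext x y
    exact (hv _).2 x y

theorem IsQPolynomialWith.trace_mul_eq_zero (h : IsQPolynomialWith d o R E) {k : ℕ}
    (hk : k ≤ d) {A : Matrix X X ℝ}
    (hA : A ∈ span ℝ (natIdem E '' Set.Iio k)) : (A * natIdem E k).trace = 0 := by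
  rw [mul_eq_zero_of_mem_span (T := {natIdem E k}) ?_ hA (subset_span rfl), Matrix.trace_zero]
  rintro _ ⟨l, hl, rfl⟩ _ rfl
  have hl : l < k := hl
  apply h.ordering.orthogonal
  intro he
  have := congrArg Fin.val he
  rw [Fin.val_ofNat, Fin.val_ofNat, Nat.mod_eq_of_lt (by omega), Nat.mod_eq_of_lt (by omega)] at this
  omega

/-- Up to scaling, `E i ⊙ E j` is a polynomial of degree `i + j` in the entries of `|X| E 1`, hence
lies in the span of `E 0, …, E (i + j)`, which is orthogonal to `E k`. -/
theorem IsQPolynomialWith.tripleSum_eq_zero (h : IsQPolynomialWith d o R E) {i j k : ℕ}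
    (hk : k ≤ d) (hijk : i + j < k) :
    tripleSum (natIdem E i) (natIdem E j) (natIdem E k) = 0 := by
  obtain ⟨v, hv, hE⟩ := h.exists_polynomials
  rw [tripleSum_eq_trace _ _ (D := natIdem E k) (h.isSymm _)]
  refine h.trace_mul_eq_zero hk ?_
  have hn := h.card_ne_zero
  set n : ℝ := (Fintype.card X : ℝ)
  have : natIdem E i ⊙ natIdem E j =
      (n⁻¹ * n⁻¹) • entrywise (n • natIdem E 1) (v i * v j) := by
    ext x y
    have hi := congrFun (congrFun (hE i (by omega)) x) y
    have hj := congrFun (congrFun (hE j (by omega)) x) y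
    simp only [Matrix.smul_apply, entrywise_apply, smul_eq_mul] at hi hj
    simp only [Matrix.hadamard_apply, Matrix.smul_apply, entrywise_apply, smul_eq_mul,
      Polynomial.eval_mul]
    rw [← hi, ← hj]
    field_simp
  rw [this]
  refine smul_mem _ _ (entrywise_mem_span hv hE (by omega) ?_)
  rw [Polynomial.degree_mul, hv i (by omega), hv j (by omega)]
  exact_mod_cast hijk

theorem IsQPolynomialWith.tripleSum_add_ne_zero (h : IsQPolynomialWith d o R E) {i j : ℕ}
    (hij : i + j ≤ d) :
    tripleSum (natIdem E i) (natIdem E j) (natIdem E (i + j)) ≠ 0 := by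
  obtain ⟨v, hv, hE⟩ := h.exists_polynomials
  have hn := h.card_ne_zero
  rw [tripleSum_eq_trace _ _ (D := natIdem E (i + j)) (h.isSymm _)]
  intro h0
  set n : ℝ := (Fintype.card X : ℝ)
  have hprod : entrywise (n • natIdem E 1) (v i * v j) =
      (n * n) • (natIdem E i ⊙ natIdem E j) := by
    ext x y
    have hi := congrFun (congrFun (hE i (by omega)) x) y
    have hj := congrFun (congrFun (hE j (by omega)) x) y
    simp only [Matrix.smul_apply, entrywise_apply, smul_eq_mul] at hi hj
    simp only [Matrix.hadamard_apply, Matrix.smul_apply, entrywise_apply, smul_eq_mul,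
      Polynomial.eval_mul]
    rw [← hi, ← hj]
    ring
  have hdeg : (v i * v j).degree = ((i + j : ℕ) : WithBot ℕ) := by
    rw [Polynomial.degree_mul, hv i (by omega), hv j (by omega)]; push_cast; rfl
  have hlead : (v i * v j).coeff (i + j) ≠ 0 := Polynomial.coeff_ne_zero_of_eq_degree hdeg
  -- Modulo polynomials of degree below `i + j`, whose matrices are orthogonal to `E (i + j)`, `v (i
  -- + j)` is a multiple of `v i * v j`. A vanishing triple sum would thus make the trace of `E (i +
  -- j)` zero.
  set c := (v (i + j)).coeff (i + j) / (v i * v j).coeff (i + j) with hc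
  have hlow : (v (i + j) - c • (v i * v j)).degree < ((i + j : ℕ) : WithBot ℕ) := by
    rw [Polynomial.degree_lt_iff_coeff_zero]
    intro k hk
    rw [Polynomial.coeff_sub, Polynomial.coeff_smul, smul_eq_mul]
    rcases hk.eq_or_lt with rfl | hk
    · rw [hc, div_mul_cancel₀ _ hlead, sub_self]
    · have h1 : (v (i + j)).coeff k = 0 :=
        Polynomial.coeff_eq_zero_of_degree_lt ((hv _ hij).trans_lt (by exact_mod_cast hk))
      have h2 : (v i * v j).coeff k = 0 :=
        Polynomial.coeff_eq_zero_of_degree_lt (hdeg.trans_lt (by exact_mod_cast hk))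
      rw [h1, h2, mul_zero, sub_zero]
  have htr := h.trace_mul_eq_zero hij (entrywise_mem_span hv hE (by omega) hlow)
  rw [map_sub, map_smul, ← hE _ hij, hprod, sub_mul, Matrix.trace_sub, smul_mul_assoc,
    smul_mul_assoc, smul_mul_assoc, Matrix.trace_smul, Matrix.trace_smul, Matrix.trace_smul, h0,
    smul_zero, smul_zero, sub_zero, smul_eq_mul, natIdem, h.ordering.idem] at htr
  exact mul_ne_zero hn (h.trace_pos _).ne' htr

/-- The principal submatrix with rows and columns in `C`. -/
def restrict {X : Type*} (C : Finset X) (A : Matrix X X ℝ) :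
    Matrix {x : X // x ∈ C} {x : X // x ∈ C} ℝ :=
  A.submatrix Subtype.val Subtype.val

@[simp]
theorem restrict_apply {X : Type*} (C : Finset X) (A : Matrix X X ℝ) (x y : {x : X // x ∈ C}) :
    restrict C A x y = A x y := rfl

theorem isSymm_restrict {X : Type*} (C : Finset X) {A : Matrix X X ℝ} (hA : A.IsSymm) :
    (restrict C A).IsSymm :=
  hA.submatrix _

theorem IsQPolynomialWith.charForm_nonneg (h : IsQPolynomialWith d o R E) (C : Finset X)
    (i : Fin (d + 1)) : 0 ≤ charForm C (E i) := by
  have := (h.posSemidef i).dotProduct_mulVec_nonneg (charVec C)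
  simpa [charForm] using this

/-- The trace is the sum of the entries of `E i ⊙ E j` over `C × C`, that is, its quadratic form at
`χ`. Expanding in the idempotents links products on `C` to the dual distribution. -/
theorem IsQPolynomialWith.trace_restrict_mul (h : IsQPolynomialWith d o R E) (C : Finset X)
    (i j : Fin (d + 1)) :
    (restrict C (E i) * restrict C (E j)).trace =
    ∑ k, (tripleSum (E i) (E j) (E k) / (E k).trace) * charForm C (E k) := by
  rw [trace_mul_eq_sum (isSymm_restrict C (h.isSymm j))]
  have h1 : ∑ k, (tripleSum (E i) (E j) (E k) / (E k).trace) * charForm C (E k) =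
      charForm C (E i ⊙ E j) := by
    rw [h.hadamard_eq_sum i j]
    simp only [charForm, Matrix.sum_mulVec, Matrix.smul_mulVec, dotProduct_sum, dotProduct_smul,
      smul_eq_mul]
  rw [h1, charForm_eq_sum, ← Finset.sum_coe_sort C (fun x => ∑ y ∈ C, (E i ⊙ E j) x y)]
  refine Finset.sum_congr rfl fun x _ => ?_
  rw [← Finset.sum_coe_sort C (fun y => (E i ⊙ E j) x y)]
  rfl

end QPolynomial

/-! ### Criteria for schemes and for the `Q`-polynomial property -/

theorem span_image_Iio_eq_of_triangular {V : Type*} [AddCommGroup V] [Module ℝ V] {F P : ℕ → V}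
    {n : ℕ} (h : ∀ i < n, P i ∈ span ℝ (F '' Set.Iio (i + 1)) ∧ P i ∉ span ℝ (F '' Set.Iio i)) :
    span ℝ (P '' Set.Iio n) = span ℝ (F '' Set.Iio n) := by
  induction n with
  | zero => simp
  | succ n ih =>
    have ih := ih fun i hi => h i (by omega)
    obtain ⟨h1, h2⟩ := h n (Nat.lt_succ_self n)
    obtain ⟨a, ha⟩ := mem_span_image_Iio_succ.1 h1
    have ha0 : a ≠ 0 := by
      rintro rfl
      exact h2 (by simpa using ha)
    ext x
    rw [mem_span_image_Iio_succ, mem_span_image_Iio_succ, ih]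
    constructor
    · rintro ⟨b, hb⟩
      refine ⟨b * a, ?_⟩
      rw [show x - (b * a) • F n = x - b • P n + b • (P n - a • F n) by module]
      exact add_mem hb (smul_mem _ _ ha)
    · rintro ⟨b, hb⟩
      refine ⟨b / a, ?_⟩
      have : x - (b / a) • P n = x - b • F n - (b / a) • (P n - a • F n) := by
        rw [smul_sub, smul_smul, div_mul_cancel₀ _ ha0]; abel
      rw [this]
      exact sub_mem hb (smul_mem _ _ ha)

theorem mul_mem_span_of_forall {Y : Type*} [Fintype Y] {S : Set (Matrix Y Y ℝ)}
    (h : ∀ A ∈ S, ∀ B ∈ S, A * B ∈ span ℝ S) {A B : Matrix Y Y ℝ} (hA : A ∈ span ℝ S)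
    (hB : B ∈ span ℝ S) : A * B ∈ span ℝ S := by
  induction hA using span_induction with
  | zero => simp
  | add x y _ _ hx hy => rw [add_mul]; exact add_mem hx hy
  | smul a x _ hx => rw [smul_mul_assoc]; exact smul_mem _ _ hx
  | mem x hx =>
    induction hB using span_induction with
    | mem y hy => exact h x hx y hy
    | zero => simp
    | add y z _ _ hy hz => rw [mul_add]; exact add_mem hy hz
    | smul a y _ hy => rw [mul_smul_comm]; exact smul_mem _ _ hy

theorem adjMat_mul_apply {X : Type*} [Fintype X] (r r' : X → X → Prop) (x y : X) :
    (adjMat r * adjMat r') x y = ({z : X | r x z ∧ r' z y}.ncard : ℝ) := by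
  classical
  rw [Matrix.mul_apply, Set.ncard_eq_toFinset_card', Set.toFinset_ofPred, Finset.natCast_card_filter]
  refine Finset.sum_congr rfl fun z _ => ?_
  by_cases h : r x z <;> by_cases h' : r' z y <;> simp [adjMat, h, h']

/-- A partition into non-empty symmetric relations, one of them equality, whose span of adjacency
matrices is closed under multiplication is a symmetric association scheme. -/
theorem isSymmAssocScheme_of_mul_mem {X ι : Type*} [Fintype X] [Fintype ι] {d : ℕ} {o : ι}
    {R : ι → X → X → Prop} (hcard : Fintype.card ι = d + 1) (hdiag : ∀ x y, R o x y ↔ x = y)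
    (hne : ∀ i, ∃ x y, R i x y) (hp : ∀ x y, ∃! i, R i x y)
    (hsymm : ∀ i x y, R i x y → R i y x)
    (hmul : ∀ A ∈ boseMesner R, ∀ B ∈ boseMesner R, A * B ∈ boseMesner R) :
    IsSymmAssocScheme d o R where
  card_index := hcard
  diag := hdiag
  nonempty := hne
  partition := hp
  symm := hsymm
  intersection_numbers := by
    choose x y hxy using hne
    refine ⟨fun i j k => {z : X | R i (x k) z ∧ R j z (y k)}.ncard, fun i j k u v huv => ?_⟩
    have h := hmul (adjMat (R i)) (subset_span ⟨i, rfl⟩) (adjMat (R j)) (subset_span ⟨j, rfl⟩)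
    rw [mem_boseMesner_iff (fun i => ⟨x i, y i, hxy i⟩) hp] at h
    have h2 := h k _ _ _ _ huv (hxy k)
    rw [adjMat_mul_apply, adjMat_mul_apply] at h2
    exact_mod_cast h2

/-- A sequence of polynomials of degrees `0, …, s` in a common matrix can be replaced by one in
the member of degree one. -/
theorem exists_polynomials_in_first {Y : Type*} {s : ℕ} {A : Fin (s + 1) → Matrix Y Y ℝ}
    {M : Matrix Y Y ℝ} {u : Fin (s + 1) → Polynomial ℝ}
    (hu : ∀ i, (u i).degree = ((i : ℕ) : WithBot ℕ)) (hA : ∀ i, A i = entrywise M (u i)) :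
    ∃ v : Fin (s + 1) → Polynomial ℝ, ∀ i, (v i).degree = ((i : ℕ) : WithBot ℕ) ∧
      ∀ x y, A i x y = (v i).eval (A 1 x y) := by
  rcases Nat.eq_zero_or_pos s with rfl | hs
  · refine ⟨u, fun i => ⟨hu i, fun x y => ?_⟩⟩
    obtain rfl : i = 0 := Fin.fin_one_eq_zero i
    have h0 : (u 0).degree ≤ 0 := (hu 0).le
    rw [hA 0, entrywise_apply, Polynomial.eq_C_of_degree_le_zero h0]
    simp
  · have h1v : (((1 : Fin (s + 1)) : ℕ)) = 1 := by
      rw [Fin.val_one', Nat.mod_eq_of_lt (by omega)]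
    have hd1 : (u 1).degree = 1 := by rw [hu 1, h1v]; rfl
    have ha : (u 1).coeff 1 ≠ 0 := Polynomial.coeff_ne_zero_of_eq_degree hd1
    have hform := Polynomial.eq_X_add_C_of_degree_le_one hd1.le
    set a := (u 1).coeff 1
    set b := (u 1).coeff 0
    -- `L` is the compositional inverse of the affine polynomial `u 1`: it recovers `M` from `A 1`,
    -- and composing with it preserves degrees.
    set L : Polynomial ℝ := Polynomial.C a⁻¹ * Polynomial.X + Polynomial.C (-(a⁻¹ * b)) with hL
    have hLdeg : L.natDegree = 1 := Polynomial.natDegree_linear (inv_ne_zero ha)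
    refine ⟨fun i => (u i).comp L, fun i => ⟨?_, fun x y => ?_⟩⟩
    · have hui : u i ≠ 0 := by
        intro h
        have := hu i
        rw [h, Polynomial.degree_zero] at this
        exact WithBot.bot_ne_coe this
      have hne : (u i).comp L ≠ 0 := by
        intro h
        rcases Polynomial.comp_eq_zero_iff.1 h with h | ⟨-, h⟩
        · exact hui h
        · rw [h, Polynomial.natDegree_C] at hLdeg
          omega
      rw [Polynomial.degree_eq_natDegree hne, Polynomial.natDegree_comp, hLdeg, mul_one,
        Polynomial.natDegree_eq_of_degree_eq_some (hu i)]
    · rw [hA i, hA 1, entrywise_apply, entrywise_apply, hform]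
      simp only [hL, Polynomial.eval_comp, Polynomial.eval_add, Polynomial.eval_mul,
        Polynomial.eval_C, Polynomial.eval_X]
      congr 1
      field_simp
      ring

theorem charForm_adjMat_ne_zero_iff {X : Type*} [Fintype X] [DecidableEq X] (C : Finset X)
    (r : X → X → Prop) : charForm C (adjMat r) ≠ 0 ↔ ∃ x ∈ C, ∃ y ∈ C, r x y := by
  have h0 : ∀ x y, 0 ≤ adjMat r x y := by
    intro x y
    by_cases h : r x y <;> simp [adjMat, h]
  rw [charForm_eq_sum, ne_eq,
    Finset.sum_eq_zero_iff_of_nonneg fun x _ => Finset.sum_nonneg fun y _ => h0 x y]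
  simp only [Finset.sum_eq_zero_iff_of_nonneg fun y _ => h0 _ y]
  push Not
  refine exists_congr fun x => and_congr_right fun _ => exists_congr fun y =>
    and_congr_right fun _ => ?_
  by_cases h : r x y <;> simp [adjMat, h]

theorem dualInnerDistribution_eq_zero_iff {X : Type*} [Fintype X] [DecidableEq X] {d : ℕ}
    (E : Fin (d + 1) → Matrix X X ℝ) {C : Finset X} (hC : C.Nonempty) (i : Fin (d + 1)) :
    dualInnerDistribution E C i = 0 ↔ charForm C (E i) = 0 := by
  have h1 : (C.card : ℝ) ≠ 0 := by exact_mod_cast hC.card_pos.ne'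
  obtain ⟨x, -⟩ := hC
  have : Nonempty X := ⟨x⟩
  have h2 : (Fintype.card X : ℝ) ≠ 0 := by exact_mod_cast Fintype.card_ne_zero
  simp [dualInnerDistribution, h1, h2]

theorem card_insert_degreeSet {X : Type*} [Fintype X] [DecidableEq X] {d : ℕ}
    (R : Fin (d + 1) → X → X → Prop) (C : Finset X) :
    (insert 0 (degreeSet R C)).card = degree R C + 1 := by
  rw [Finset.card_insert_of_notMem, degree]
  simp [degreeSet]

theorem smul_restrict_eq_entrywise {X : Type*} [Fintype X] {d : ℕ}
    {E : Fin (d + 1) → Matrix X X ℝ} (C : Finset X)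
    {v : ℕ → Polynomial ℝ}
    (hE : ∀ k ≤ d, (Fintype.card X : ℝ) • natIdem E k =
        entrywise ((Fintype.card X : ℝ) • natIdem E 1) (v k)) {k : ℕ} (hk : k ≤ d) :
    (Fintype.card X : ℝ) • restrict C (natIdem E k) =
      entrywise (restrict C ((Fintype.card X : ℝ) • natIdem E 1)) (v k) := by
  ext x y
  exact congrFun (congrFun (hE k hk) x.1) y.1

/-! ### Restriction of the scheme to `C` -/

section Restricted

variable {X : Type*} [Fintype X] [DecidableEq X] {d : ℕ} {R : Fin (d + 1) → X → X → Prop}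

theorem degree_le (R : Fin (d + 1) → X → X → Prop) (C : Finset X) : degree R C ≤ d := by
  have h := Finset.card_le_univ (insert 0 (degreeSet R C))
  rw [card_insert_degreeSet, Fintype.card_fin] at h
  omega

theorem IsSymmAssocScheme.restrictedRel_nonempty (h : IsSymmAssocScheme d 0 R) {C : Finset X}
    (hC : C.Nonempty) (i : {i : Fin (d + 1) // i ∈ insert 0 (degreeSet R C)}) :
    ∃ x y, restrictedRel R C i x y := by
  obtain ⟨i, hi⟩ := i
  rcases Finset.mem_insert.1 hi with rfl | hi'
  · obtain ⟨x, hx⟩ := hC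
    exact ⟨⟨x, hx⟩, ⟨x, hx⟩, (h.diag x x).2 rfl⟩
  · obtain ⟨x, hx, y, hy, hxy⟩ :=
      (charForm_adjMat_ne_zero_iff C (R i)).1 (Finset.mem_filter.1 hi').2.2
    exact ⟨⟨x, hx⟩, ⟨y, hy⟩, hxy⟩

theorem IsSymmAssocScheme.restrictedRel_partition (h : IsSymmAssocScheme d 0 R) {C : Finset X}
    (x y : {x : X // x ∈ C}) : ∃! i, restrictedRel R C i x y := by
  obtain ⟨k, hk, huniq⟩ := h.partition x.1 y.1
  refine ⟨⟨k, ?_⟩, hk, fun j hj => Subtype.ext (huniq j.1 hj)⟩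
  rw [Finset.mem_insert]
  by_cases hk0 : k = 0
  · exact Or.inl hk0
  · refine Or.inr (Finset.mem_filter.2 ⟨Finset.mem_univ _, ?_,
      (charForm_adjMat_ne_zero_iff C (R k)).2 ⟨x, x.2, y, y.2, hk⟩⟩)
    exact Nat.one_le_iff_ne_zero.2 fun h0 => hk0 (Fin.ext h0)

variable {E : Fin (d + 1) → Matrix X X ℝ}

/-- The entries of `E 1` separate the relations of a `Q`-polynomial scheme. -/
theorem IsQPolynomialWith.rel_of_apply_eq (h : IsQPolynomialWith d 0 R E) {i : Fin (d + 1)}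
    {x y x' y' : X} (hxy : R i x y) (hE : E 1 x y = E 1 x' y') : R i x' y' := by
  obtain ⟨v, hv⟩ := h.polynomial
  -- Equality of the entries of `E 1` passes to every `E j` through `v j`, hence to the whole
  -- algebra, adjacency matrices included.
  have hall : ∀ B ∈ boseMesner R, B x y = B x' y' := by
    intro B hB
    rw [← h.ordering.span_eq] at hB
    induction hB using span_induction with
    | mem A hA =>
      obtain ⟨j, rfl⟩ := hA
      have h1 := (hv j).2 x y
      rw [hE, ← (hv j).2 x' y'] at h1
      exact mul_left_cancel₀ h.card_ne_zero h1
    | zero => rfl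
    | add A A' _ _ hA hA' => rw [Matrix.add_apply, Matrix.add_apply, hA, hA']
    | smul a A _ hA => rw [Matrix.smul_apply, Matrix.smul_apply, hA]
  by_contra hn
  have h2 := hall _ (subset_span ⟨i, rfl⟩)
  simp [adjMat, hxy, hn] at h2

theorem IsQPolynomialWith.restrict_mem (h : IsQPolynomialWith d 0 R E) {C : Finset X}
    (hC : C.Nonempty) {B : Matrix X X ℝ} (hB : B ∈ boseMesner R) :
    restrict C B ∈ boseMesner (restrictedRel R C) := by
  rw [mem_boseMesner_iff (h.scheme.restrictedRel_nonempty hC) h.scheme.restrictedRel_partition]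
  intro i x y x' y' hxy hxy'
  exact h.scheme.mem_boseMesner_iff.1 hB i.1 _ _ _ _ hxy hxy'

/-- The restrictions of `E 0, …, E s`, where `s` is the degree of `C`, span the span of the
restricted adjacency matrices. -/
theorem IsQPolynomialWith.span_restrict (h : IsQPolynomialWith d 0 R E) {C : Finset X}
    (hC : C.Nonempty) :
    span ℝ ((fun k => restrict C (natIdem E k)) '' Set.Iio (degree R C + 1)) =
      boseMesner (restrictedRel R C) := by
  obtain ⟨v, hv, hE⟩ := h.exists_polynomials
  apply le_antisymm
  · rw [span_le]
    rintro _ ⟨k, -, rfl⟩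
    exact h.restrict_mem hC (h.ordering.mem _)
  · intro B hB
    rw [mem_boseMesner_iff (h.scheme.restrictedRel_nonempty hC)
      h.scheme.restrictedRel_partition] at hB
    choose x y hxy using h.scheme.restrictedRel_nonempty (C := C) hC
    set M := restrict C ((Fintype.card X : ℝ) • natIdem E 1)
    have hinj : Function.Injective fun i => M (x i) (y i) := by
      intro i j hij
      have h1 : natIdem E 1 (x i).1 (y i).1 = natIdem E 1 (x j).1 (y j).1 :=
        mul_left_cancel₀ h.card_ne_zero hij
      have h2 := h.rel_of_apply_eq (hxy i) h1
      exact (h.scheme.restrictedRel_partition (x j) (y j)).unique h2 (hxy j)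
    -- There are `s + 1` restricted relations, with distinct values of `M`, so interpolation needs
    -- degree at most `s`.
    set p := Lagrange.interpolate Finset.univ (fun i => M (x i) (y i)) fun i => B (x i) (y i)
    have hdeg : p.degree < ((degree R C + 1 : ℕ) : WithBot ℕ) := by
      have := Lagrange.degree_interpolate_lt (s := Finset.univ) (fun i => B (x i) (y i))
        (hinj.injOn)
      rwa [Finset.card_univ, Fintype.card_coe, card_insert_degreeSet] at this
    have hBp : B = entrywise M p := by
      ext u w
      obtain ⟨k, hk, -⟩ := h.scheme.restrictedRel_partition u w
      have hMk : M u w = M (x k) (y k) := by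
        have := h.restrict_mem hC (smul_mem _ (Fintype.card X : ℝ)
          (h.ordering.mem (Fin.ofNat (d + 1) 1)))
        rw [mem_boseMesner_iff (h.scheme.restrictedRel_nonempty hC)
          h.scheme.restrictedRel_partition] at this
        exact this k _ _ _ _ hk (hxy k)
      rw [entrywise_apply, hMk, hB k _ _ _ _ hk (hxy k)]
      exact (Lagrange.eval_interpolate_at_node (fun i => B (x i) (y i)) hinj.injOn
        (Finset.mem_univ k)).symm
    rw [hBp]
    exact entrywise_mem_span hv (fun k hk => smul_restrict_eq_entrywise C hE hk)
      (by have := degree_le R C; omega) hdeg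

theorem charForm_natIdem_zero_ne_zero (h : IsQPolynomialWith d 0 R E) {C : Finset X}
    (hC : C.Nonempty) : charForm C (natIdem E 0) ≠ 0 := by
  have h1 : (C.card : ℝ) ≠ 0 := by exact_mod_cast hC.card_pos.ne'
  have h2 := h.card_ne_zero
  have h0 : natIdem E 0 = E 0 := rfl
  rw [h0, h.ordering.zero_eq, charForm_eq_sum]
  simp [h1, h2]

/-- A dual zero interval can be extended downwards until it is preceded by a non-zero entry of
the dual inner distribution. -/
theorem HasDualZeroInterval.exists_left_maximal (h : IsQPolynomialWith d 0 R E) {C : Finset X}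
    (hC : C.Nonempty) {w t : ℕ} (hwt : HasDualZeroInterval E C w t) :
    ∃ w' ≤ w, charForm C (natIdem E w') ≠ 0 ∧
      ∀ k, w' < k → k ≤ w + t → charForm C (natIdem E k) = 0 := by
  classical
  -- Index `0` always qualifies, since `χᵀ E_0 χ = |C|² / |X|`.
  refine ⟨Nat.findGreatest (fun k => charForm C (natIdem E k) ≠ 0) w, Nat.findGreatest_le w,
    Nat.findGreatest_spec (P := fun k => charForm C (natIdem E k) ≠ 0) (Nat.zero_le w)
      (charForm_natIdem_zero_ne_zero h hC), fun k hk hkt => ?_⟩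
  rcases le_or_gt k w with hkw | hkw
  · exact not_not.1 (Nat.findGreatest_is_greatest hk hkw)
  · have hkd : k < d + 1 := by have := hwt.add_le; omega
    have := hwt.vanish ⟨k, hkd⟩ hkw hkt
    rw [dualInnerDistribution_eq_zero_iff E hC] at this
    rwa [← natIdem_val E ⟨k, hkd⟩] at this

theorem IsQPolynomialWith.trace_restrict_natIdem_mul (h : IsQPolynomialWith d 0 R E)
    (C : Finset X) (i j : ℕ) :
    (restrict C (natIdem E i) * restrict C (natIdem E j)).trace =
      ∑ k : Fin (d + 1), (tripleSum (natIdem E i) (natIdem E j) (natIdem E k) /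
        (E k).trace) * charForm C (natIdem E k) := by
  simp only [natIdem_val]
  exact h.trace_restrict_mul C _ _

theorem IsQPolynomialWith.restrict_mul_eq_zero (h : IsQPolynomialWith d 0 R E) {C : Finset X}
    {w' m : ℕ} (hz : ∀ k, w' < k → k ≤ m → charForm C (natIdem E k) = 0) {i k : ℕ} (hki : k < i)
    (hm : w' + i + k ≤ m) (hd : w' + i ≤ d) :
    restrict C (natIdem E (w' + i)) * restrict C (natIdem E k) = 0 := by
  refine PosSemidef.mul_eq_zero_of_trace_eq_zero ((h.posSemidef _).submatrix _)
    ((h.posSemidef _).submatrix _) ?_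
  refine (h.trace_restrict_natIdem_mul C (w' + i) k).trans (Finset.sum_eq_zero fun l _ => ?_)
  -- An index `l` in `(w', m]` is killed by the zero interval, `l > m` by `w' + i + k < l`, and `l ≤
  -- w'` by `k + l < w' + i` after permuting the triple.
  by_cases h1 : w' < (l : ℕ)
  · by_cases h2 : (l : ℕ) ≤ m
    · rw [hz _ h1 h2, mul_zero]
    · rw [h.tripleSum_eq_zero (by omega) (by omega), zero_div, zero_mul]
  · rw [tripleSum_swap, tripleSum_comm, h.tripleSum_eq_zero hd (by omega), zero_div, zero_mul]

/-- All terms of the trace are non-negative, and the one at `w'` is non-zero because the Krein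
parameter for `w'`, `i`, `w' + i` is extremal. -/
theorem IsQPolynomialWith.restrict_mul_ne_zero (h : IsQPolynomialWith d 0 R E) {C : Finset X}
    {w' : ℕ} (hw : charForm C (natIdem E w') ≠ 0) {i : ℕ} (hd : w' + i ≤ d) :
    restrict C (natIdem E (w' + i)) * restrict C (natIdem E i) ≠ 0 := by
  intro h0
  have htr := h.trace_restrict_natIdem_mul C (w' + i) i
  rw [h0, Matrix.trace_zero] at htr
  have hnonneg : ∀ k ∈ (Finset.univ : Finset (Fin (d + 1))),
      0 ≤ (tripleSum (natIdem E (w' + i)) (natIdem E i) (natIdem E k) /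
        (E k).trace) * charForm C (natIdem E k) := fun k _ =>
    mul_nonneg (div_nonneg (h.tripleSum_nonneg _ _ _) (h.trace_pos k).le) (h.charForm_nonneg C _)
  have h1 := (Finset.sum_eq_zero_iff_of_nonneg hnonneg).1 htr.symm ⟨w', by omega⟩
    (Finset.mem_univ _)
  rcases mul_eq_zero.1 h1 with h2 | h2
  · rcases div_eq_zero_iff.1 h2 with h3 | h3
    · rw [tripleSum_comm, tripleSum_swap, tripleSum_comm] at h3
      exact h.tripleSum_add_ne_zero hd h3
    · exact (h.trace_pos _).ne' h3
  · exact hw h2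

end Restricted

section Restricted

variable {X : Type*} [Fintype X] [DecidableEq X] {d : ℕ} {R : Fin (d + 1) → X → X → Prop}
  {E : Fin (d + 1) → Matrix X X ℝ}

theorem IsQPolynomialWith.exists_restricted_idempotents (h : IsQPolynomialWith d 0 R E)
    {C : Finset X} (hC : C.Nonempty) {w t : ℕ} (hwt : HasDualZeroInterval E C w t)
    (hs : 2 * (degree R C : ℤ) - 1 ≤ (t : ℤ)) :
    ∃ P : ℕ → Matrix {x : X // x ∈ C} {x : X // x ∈ C} ℝ,
      (∀ i ≤ degree R C, P i * P i = P i) ∧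
      (∀ i ≤ degree R C, ∀ j ≤ degree R C, i ≠ j → P i * P j = 0) ∧
      ∑ i ∈ Finset.range (degree R C + 1), P i = 1 ∧
      ∀ i ≤ degree R C,
        P i ∈ span ℝ ((fun k => restrict C (natIdem E k)) '' Set.Iio (i + 1)) ∧
        P i ∉ span ℝ ((fun k => restrict C (natIdem E k)) '' Set.Iio i) := by
  obtain ⟨w', hw', hw0, hz⟩ := hwt.exists_left_maximal h hC
  have hwd := hwt.add_le
  have hsymm : ∀ k, (restrict C (natIdem E k)).IsSymm := fun k => isSymm_restrict C (h.isSymm _)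
  have hone : (1 : Matrix {x : X // x ∈ C} {x : X // x ∈ C} ℝ) ∈
      boseMesner (restrictedRel R C) := by
    have h1 : (1 : Matrix X X ℝ) ∈ boseMesner R := by
      rw [← h.ordering.sum_eq_one]
      exact sum_mem fun i _ => h.ordering.mem i
    have h2 : restrict C (1 : Matrix X X ℝ) = 1 := Matrix.submatrix_one _ Subtype.val_injective
    rw [← h2]
    exact h.restrict_mem hC h1
  refine exists_orthogonal_idempotents
    -- At index `0` triangularity asks only that `G 0 * F 0 ≠ 0`, so the identity serves.
    (G := fun i => if i = 0 then 1 else restrict C (natIdem E (w' + i))) hsymm ?_ ?_ ?_ ?_ ?_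
  · intro i
    split_ifs
    · exact Matrix.isSymm_one
    · exact hsymm _
  · rw [h.span_restrict hC]; exact hone
  · intro i _
    rw [h.span_restrict hC]
    split_ifs
    · exact hone
    · exact h.restrict_mem hC (h.ordering.mem _)
  · intro i hi k hk
    rw [if_neg (by omega)]
    -- Here `k < i ≤ s` gives `i + k ≤ 2s - 1 ≤ t`, so `w' + i + k ≤ w + t ≤ d`.
    exact h.restrict_mul_eq_zero hz hk (by omega) (by omega)
  · intro i hi
    split_ifs with hi0
    · subst hi0
      rw [one_mul]
      intro h0
      obtain ⟨x, hx⟩ := hC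
      have h1 := congrFun (congrFun h0 ⟨x, hx⟩) ⟨x, hx⟩
      rw [restrict_apply, show natIdem E 0 = E 0 from rfl, h.ordering.zero_eq] at h1
      simp [h.card_ne_zero] at h1
    · exact h.restrict_mul_ne_zero hw0 (by omega)

end Restricted

end QPolyScheme

end

/-! ### The restricted scheme and its `Q`-polynomial ordering -/

open QPolyScheme Matrix Submodule in
theorem mainTheorem4 {X : Type*} [Fintype X] [DecidableEq X] (d : ℕ)
    (R : Fin (d + 1) → X → X → Prop) (E : Fin (d + 1) → Matrix X X ℝ)
    (hQ : QPolyScheme.IsQPolynomialWith d 0 R E)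
    (C : Finset X) (hC : C.Nonempty) (w t : ℕ)
    (hwt : QPolyScheme.HasDualZeroInterval E C w t)
    (hs : 2 * (QPolyScheme.degree R C : ℤ) - 1 ≤ (t : ℤ)) :
    QPolyScheme.IsQPolynomialScheme (QPolyScheme.degree R C)
      (⟨0, Finset.mem_insert_self 0 (QPolyScheme.degreeSet R C)⟩ :
        {i : Fin (d + 1) // i ∈ insert 0 (QPolyScheme.degreeSet R C)})
      (QPolyScheme.restrictedRel R C) := by
  obtain ⟨P, hidem, horth, hsum, hP⟩ := hQ.exists_restricted_idempotents hC hwt hs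
  obtain ⟨v, hv, hE⟩ := hQ.exists_polynomials
  have hsd := degree_le R C
  have hF := fun k hk => smul_restrict_eq_entrywise (k := k) C hE hk
  have hspan : span ℝ (P '' Set.Iio (degree R C + 1)) = boseMesner (restrictedRel R C) :=
    (span_image_Iio_eq_of_triangular fun i hi => hP i (by omega)).trans (hQ.span_restrict hC)
  have hmul : ∀ A ∈ boseMesner (restrictedRel R C), ∀ B ∈ boseMesner (restrictedRel R C),
      A * B ∈ boseMesner (restrictedRel R C) := by
    rw [← hspan]
    intro A hA B hB
    refine mul_mem_span_of_forall ?_ hA hB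
    rintro _ ⟨i, hi, rfl⟩ _ ⟨j, hj, rfl⟩
    rcases eq_or_ne i j with rfl | hij
    · rw [hidem i (Nat.lt_succ_iff.1 hi)]
      exact subset_span ⟨i, hi, rfl⟩
    · rw [horth i (Nat.lt_succ_iff.1 hi) j (Nat.lt_succ_iff.1 hj) hij]
      exact zero_mem _
  have hCcard : (Fintype.card {x : X // x ∈ C} : ℝ) ≠ 0 := by
    have : Nonempty {x : X // x ∈ C} := hC.to_subtype
    exact_mod_cast Fintype.card_ne_zero
  have hpoly : ∀ i : Fin (degree R C + 1), ∃ p : Polynomial ℝ,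
      p.degree = ((i : ℕ) : WithBot ℕ) ∧
      P i = entrywise (restrict C ((Fintype.card X : ℝ) • natIdem E 1)) p := by
    intro i
    have hi : (i : ℕ) ≤ degree R C := Nat.lt_succ_iff.1 i.2
    obtain ⟨p, hp, hPp⟩ := exists_entrywise_of_mem_span hv hQ.card_ne_zero hF (by omega) (hP i hi).1
    -- The degree is at most `i` because `P i` lies in the span of `F 0, …, F i`; a smaller degree
    -- would put `P i` in the span of the `F k` with `k < i`.
    refine ⟨p, le_antisymm ((Polynomial.degree_le_iff_coeff_zero _ _).2 fun m hm =>
      (Polynomial.degree_lt_iff_coeff_zero _ _).1 hp m (by exact_mod_cast hm)) ?_, hPp⟩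
    by_contra hlt
    refine (hP i hi).2 ?_
    rw [hPp]
    exact entrywise_mem_span hv hF (by omega) (not_le.1 hlt)
  choose p hp hPp using hpoly
  refine ⟨fun i => P i, ?_, ?_, ?_⟩
  · refine isSymmAssocScheme_of_mul_mem ?_ ?_ (hQ.scheme.restrictedRel_nonempty hC)
      hQ.scheme.restrictedRel_partition ?_ hmul
    · rw [← card_insert_degreeSet]
      exact Fintype.card_of_subtype _ fun _ => Iff.rfl
    · intro x y
      exact (hQ.scheme.diag x.1 y.1).trans Subtype.ext_iff.symm
    · intro i x y hxy
      exact hQ.scheme.symm i.1 x.1 y.1 hxy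
  · have hle : ∀ i : Fin (degree R C + 1), (i : ℕ) ≤ degree R C := fun i => Nat.lt_succ_iff.1 i.2
    refine ⟨fun i h0 => ?_, fun i => hidem i (hle i), fun i j hij => ?_, ?_, ?_, ?_⟩
    · refine (hP i (hle i)).2 ?_
      rw [show P i = 0 from h0]
      exact zero_mem _
    · exact horth i (hle i) j (hle j) fun h => hij (Fin.ext h)
    · rw [← hsum, Finset.sum_range]
    · rw [← hspan]
      congr 1
      ext A
      constructor
      · rintro ⟨i, rfl⟩
        exact ⟨i, i.2, rfl⟩
      · rintro ⟨i, hi, rfl⟩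
        exact ⟨⟨i, hi⟩, rfl⟩
    -- `p 0` is a non-zero constant `c`, so `P 0` has all entries `c`, and idempotency reads `|C| c²
    -- = c`.
    · have h00 := hPp 0
      have hdeg : (p 0).degree ≤ 0 := (hp 0).le
      rw [Polynomial.eq_C_of_degree_le_zero hdeg] at h00
      have hc : (p 0).coeff 0 ≠ 0 := Polynomial.coeff_ne_zero_of_eq_degree (hp 0)
      obtain ⟨x, hx⟩ := hC
      have hi := congrFun (congrFun (hidem 0 (Nat.zero_le _)) ⟨x, hx⟩) ⟨x, hx⟩
      simp only [Fin.val_zero] at h00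
      rw [h00, Matrix.mul_apply] at hi
      simp only [entrywise_apply, Polynomial.eval_C, Finset.sum_const, Finset.card_univ,
        nsmul_eq_mul] at hi
      have hval : (p 0).coeff 0 = (Fintype.card {x : X // x ∈ C} : ℝ)⁻¹ := by
        refine eq_inv_of_mul_eq_one_left ?_
        apply mul_right_cancel₀ hc
        linarith
      ext y z
      simp only [Fin.val_zero]
      rw [h00, hval]
      simp
  · refine exists_polynomials_in_first
      (A := fun i : Fin (degree R C + 1) => (Fintype.card {x : X // x ∈ C} : ℝ) • P i)
      (M := restrict C ((Fintype.card X : ℝ) • natIdem E 1))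
      (u := fun i => (Fintype.card {x : X // x ∈ C} : ℝ) • p i) ?_ ?_
    · intro i
      rw [Polynomial.degree_smul_of_smul_regular _ (IsSMulRegular.of_ne_zero hCcard), hp i]
    · intro i
      rw [map_smul, ← hPp i]
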